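/- \textbf{Definitions.} An \emph{integral Hodge structure} $(L,h)$ is a free $\mathbb Z$-module $L$ of finite rank together with a decomposition $L_{\mathbb C}=\bigoplus_{(p,q)\in\mathbb Z^2}L^{p,q}$ into complex subspaces with $\overline{L^{p,q}}=L^{q,p}$, such that $L=\bigoplus_{n\in\mathbb Z}L^n$, where $L^n=L\cap (L_{\mathbb R})^n$ and $(L_{\mathbb R})^n=L_{\mathbb R}\cap\bigoplus_{p+q=n}L^{p,q}$. Here $h:\mathbb C^\times\to \mathrm{GL}(L_{\mathbb R})$ is the associated representation, for which $h(z)$ acts on $L^{p,q}$ as $z^{-p}\bar z^{-q}$. Put $\mathbb Z(n)=(2\pi i)^n\mathbb Z\subset\mathbb C$ and $\mathbb R(n)=(2\pi i)^n\mathbb R$. A \emph{polarisation} of $(L,h)$ is a $\mathbb Z$-bilinear map $\psi:L\times L\to\bigoplus_{n\in\mathbb Z}\mathbb Z(-n)$ such that $\psi(L^n,L^m)=0$ for $n\ne m$, $\psi(L^n,L^n)\subseteq\mathbb Z(-n)$ for all $n$, and such that for every $n$ the $\mathbb R$-bilinear extension $\psi_{\mathbb R}:(L_{\mathbb R})^n\times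 (L_{\mathbb R})^n\to\mathbb R(-n)$ satisfies $\psi_{\mathbb R}(h(z)x,h(z)y)=(z\bar z)^{-n}\psi_{\mathbb R}(x,y)$ for all $z\in\mathbb C^\times$, and the real form $(x,y)\mapsto(2\pi i)^n\psi_{\mathbb R}(x,h(i)y)$ is symmetric and positive definite. Then $(L,\psi,h)$ is called a \emph{polarised integral Hodge structure}. A \emph{Hodge substructure} of $(L,\psi,h)$ is a subgroup $N\subseteq L$ such that $N_{\mathbb R}\subseteq L_{\mathbb R}$ is stable under $h(\mathbb C^\times)$. An \emph{orthogonal decomposition} $N=N_1\perp\dots\perp N_r$ ($r\ge 0$) is a direct sum decomposition of $N$ into Hodge substructures $N_i$ with $\psi(N_i,N_j)=0$ for $i\ne j$. A Hodge substructure $N$ is \emph{indecomposable} if $N\neq0$ and for every orthogonal decomposition $N=M_1\perp M_2$ one has $M_1=0$ or $M_2=0$. \textbf{Theorem.} Let $(L,\psi,h)$ be a polarised integral Hodge structure (not necessarily of pure weight). If $$L=L_1\perp\dots\perp L_r\quad\text{and}\quad L=L'_1\perp\dots\perp L'_s$$ are two orthogonal decompositions of $L$ into indecomposable Hodge substructures,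 then $\{L_1,\dots,L_r\}=\{L'_1,\dots,L'_s\}$ as sets of sublattices of $L$. -/

import Mathlib

open scoped TensorProduct DirectSum ComplexConjugate

noncomputable section

namespace Hodge

/-! ### Real Hodge structures -/

section Real

variable (V : Type*) [AddCommGroup V] [Module ℝ V]

/-- Complex conjugation `v ⊗ z ↦ v ⊗ z̄` on `V_ℂ = ℂ ⊗ V`. -/
def conjC : ℂ ⊗[ℝ] V →ₗ[ℝ] ℂ ⊗[ℝ] V :=
  LinearMap.rTensor V Complex.conjAe.toLinearMap

/-- The inclusion `V → V_ℂ`, `v ↦ 1 ⊗ v`. -/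
def inclC : V →ₗ[ℝ] ℂ ⊗[ℝ] V := TensorProduct.mk ℝ ℂ V 1

/-- The real part `V_ℂ → V`, `z ⊗ v ↦ Re(z) v`. -/
def reC : ℂ ⊗[ℝ] V →ₗ[ℝ] V :=
  (TensorProduct.lid ℝ V).toLinearMap ∘ₗ LinearMap.rTensor V Complex.reLm

/-- A Hodge decomposition of a real vector space `V`: a decomposition
`V_ℂ = ⨁ V^{p,q}` with `conj (V^{p,q}) = V^{q,p}`. -/
structure HodgeDecomposition where
  piece : ℤ × ℤ → Submodule ℂ (ℂ ⊗[ℝ] V)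
  isInternal : DirectSum.IsInternal piece
  conj_piece : ∀ p q : ℤ, conjC V '' (piece (p, q) : Set (ℂ ⊗[ℝ] V)) = piece (q, p)

variable {V}

namespace HodgeDecomposition

variable (H : HodgeDecomposition V)

/-- The weight `n` subspace `V^n` of `V`: `V^n_ℂ = ⨁_{p+q=n} V^{p,q}`. -/
def weight (n : ℤ) : Submodule ℝ V :=
  ((⨆ pq : {pq : ℤ × ℤ // pq.1 + pq.2 = n}, H.piece pq.1).restrictScalars ℝ).comap (inclC V)

lemma bijective_coeLinearMap : Function.Bijective (DirectSum.coeLinearMap H.piece) :=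
  H.isInternal

/-- The action of `𝕊(ℂ) = ℂˣ × ℂˣ` on `V_ℂ`: `(z₁, z₂)` acts on `V^{p,q}` as the scalar
`z₁^{-p} z₂^{-q}`. -/
def hC (z₁ z₂ : ℂˣ) : ℂ ⊗[ℝ] V →ₗ[ℂ] ℂ ⊗[ℝ] V :=
  (DirectSum.toModule ℂ (ℤ × ℤ) (ℂ ⊗[ℝ] V)
      fun pq => ((z₁ ^ (-pq.1) * z₂ ^ (-pq.2) : ℂˣ) : ℂ) • (H.piece pq).subtype) ∘ₗ
    (LinearEquiv.ofBijective (DirectSum.coeLinearMap H.piece) H.bijective_coeLinearMap).symm.toLinearMap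

/-- The action `h` of `𝕊(ℝ) = ℂˣ` on `V`. The operator `hC z z̄` preserves the real subspace
`V` of `V_ℂ` (see `inclC_h`), and `h z` is its restriction to `V`. -/
def h (z : ℂˣ) : V →ₗ[ℝ] V :=
  reC V ∘ₗ (H.hC z (star z)).restrictScalars ℝ ∘ₗ inclC V

/-- The Weil operator `C = h(i)`. -/
def weil : V →ₗ[ℝ] V := H.h (Units.mk0 Complex.I Complex.I_ne_zero)

lemma hC_apply (z₁ z₂ : ℂˣ) (pq : ℤ × ℤ) {v : ℂ ⊗[ℝ] V} (hv : v ∈ H.piece pq) :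
    H.hC z₁ z₂ v = ((z₁ ^ (-pq.1) * z₂ ^ (-pq.2) : ℂˣ) : ℂ) • v := by
  have h1 : (LinearEquiv.ofBijective (DirectSum.coeLinearMap H.piece) H.bijective_coeLinearMap).symm v =
      DirectSum.lof ℂ (ℤ × ℤ) (fun i => H.piece i) pq ⟨v, hv⟩ := by
    rw [LinearEquiv.symm_apply_eq]
    simp [DirectSum.coeLinearMap_lof]
  simp [hC, h1]

lemma conjC_smul (c : ℂ) (x : ℂ ⊗[ℝ] V) : conjC V (c • x) = conj c • conjC V x := by
  induction x using TensorProduct.induction_on with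
  | zero => simp
  | tmul a v => simp [conjC, TensorProduct.smul_tmul']
  | add x y hx hy => simp [smul_add, hx, hy]

lemma hC_conjC (z : ℂˣ) (x : ℂ ⊗[ℝ] V) :
    H.hC z (star z) (conjC V x) = conjC V (H.hC z (star z) x) := by
  have hx : x ∈ ⨆ pq, H.piece pq := by
    rw [H.isInternal.submodule_iSup_eq_top]; trivial
  induction hx using Submodule.iSup_induction' with
  | mem pq v hv =>
    have hv' : conjC V v ∈ H.piece (pq.2, pq.1) := by
      rw [← SetLike.mem_coe, ← H.conj_piece pq.1 pq.2]
      exact Set.mem_image_of_mem _ hv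
    rw [H.hC_apply z (star z) (pq.2, pq.1) hv', H.hC_apply z (star z) pq hv, conjC_smul]
    congr 1
    simp [mul_comm]
  | zero => simp
  | add x y _ _ hx hy => simp [hx, hy]

lemma inclC_reC (x : ℂ ⊗[ℝ] V) : (2 : ℝ) • inclC V (reC V x) = x + conjC V x := by
  induction x using TensorProduct.induction_on with
  | zero => simp
  | tmul a v =>
    simp only [inclC, reC, conjC, LinearMap.comp_apply, LinearMap.rTensor_tmul,
      TensorProduct.mk_apply, LinearEquiv.coe_coe, TensorProduct.lid_tmul,
      AlgEquiv.toLinearMap_apply, Complex.conjAe_coe, ← TensorProduct.add_tmul,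
      Complex.add_conj, TensorProduct.tmul_smul, TensorProduct.smul_tmul']
    congr 1
    apply Complex.ext <;> simp
  | add x y hx hy => rw [map_add, map_add, smul_add, hx, hy, map_add]; abel

/-- `h z` is the restriction of `hC z z̄` to `V`. -/
lemma inclC_h (z : ℂˣ) (v : V) : inclC V (H.h z v) = H.hC z (star z) (inclC V v) := by
  have h1 := inclC_reC (H.hC z (star z) (inclC V v))
  have h2 : conjC V (inclC V v) = inclC V v := by simp [conjC, inclC]
  rw [← H.hC_conjC, h2, ← two_smul ℝ] at h1
  exact smul_right_injective _ (two_ne_zero (α := ℝ)) h1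

end HodgeDecomposition

end Real

/-! ### Integral Hodge structures -/

section Integral

variable (L : Type*) [AddCommGroup L]

/-- The inclusion `L → L_ℝ = ℝ ⊗ L`, `x ↦ 1 ⊗ x`. -/
def inclR : L →ₗ[ℤ] ℝ ⊗[ℤ] L := TensorProduct.mk ℤ ℝ L 1

/-- An integral Hodge structure on the lattice `L`: a Hodge decomposition of `L_ℝ` such that
`L = ⨁ₙ L ∩ (L_ℝ)^n`. -/
structure IntegralHodgeStructure [Module.Free ℤ L] [Module.Finite ℤ L]
    extends HodgeDecomposition (ℝ ⊗[ℤ] L) where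
  weight_isInternal : DirectSum.IsInternal fun n : ℤ =>
    ((toHodgeDecomposition.weight n).restrictScalars ℤ).comap (inclR L)

variable {L}

/-- The weight `n` sublattice `L^n = L ∩ (L_ℝ)^n`. -/
def IntegralHodgeStructure.latticeWeight [Module.Free ℤ L] [Module.Finite ℤ L]
    (H : IntegralHodgeStructure L) (n : ℤ) : Submodule ℤ L :=
  ((H.weight n).restrictScalars ℤ).comap (inclR L)

/-- The lattice `ℤ(n) = (2πi)^n ℤ` in `ℂ`. -/
def tate (n : ℤ) : Submodule ℤ ℂ :=
  Submodule.span ℤ {(2 * Real.pi * Complex.I : ℂ) ^ n}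

/-- The `ℝ`-bilinear extension `L_ℝ × L_ℝ → ℂ` of a `ℤ`-bilinear map `L × L → ℂ`. -/
def extendR (B : L →ₗ[ℤ] L →ₗ[ℤ] ℂ) : (ℝ ⊗[ℤ] L) →ₗ[ℝ] (ℝ ⊗[ℤ] L) →ₗ[ℝ] ℂ :=
  LinearMap.liftBaseChange ℝ
    (((LinearMap.liftBaseChangeEquiv (R := ℤ) (M := L) (N := ℂ) ℝ).toLinearMap.restrictScalars ℤ)
      ∘ₗ B)

lemma extendR_tmul (B : L →ₗ[ℤ] L →ₗ[ℤ] ℂ) (a b : ℝ) (x y : L) :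
    extendR B (a ⊗ₜ x) (b ⊗ₜ y) = a * b * B x y := by
  simp [extendR, mul_assoc]

/-- The component `L × L → ℤ(-n) ⊆ ℂ` of a pairing `ψ : L × L → ⨁ₙ ℤ(-n)`. -/
def pairingComponent (ψ : L →ₗ[ℤ] L →ₗ[ℤ] ⨁ n : ℤ, tate (-n)) (n : ℤ) :
    L →ₗ[ℤ] L →ₗ[ℤ] ℂ :=
  ψ.compr₂ ((tate (-n)).subtype ∘ₗ DirectSum.component ℤ ℤ (fun n : ℤ => tate (-n)) n)

/-- The form `φ(x, y) = (2πi)^n ψ_ℝ(x, C y)` attached to the weight `n` component of `ψ`, where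
`C = h(i)`. The complex number `(2πi)^n ψ_ℝ(x, C y)` is always real (see `coe_hodgeForm`). -/
def hodgeForm [Module.Free ℤ L] [Module.Finite ℤ L] (H : IntegralHodgeStructure L)
    (ψ : L →ₗ[ℤ] L →ₗ[ℤ] ⨁ n : ℤ, tate (-n)) (n : ℤ) (x y : ℝ ⊗[ℤ] L) : ℝ :=
  ((2 * Real.pi * Complex.I : ℂ) ^ n * extendR (pairingComponent ψ n) x (H.weil y)).re

lemma im_mul_extendR (ψ : L →ₗ[ℤ] L →ₗ[ℤ] ⨁ n : ℤ, tate (-n)) (n : ℤ) (x y : ℝ ⊗[ℤ] L) :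
    ((2 * Real.pi * Complex.I : ℂ) ^ n * extendR (pairingComponent ψ n) x y).im = 0 := by
  induction x using TensorProduct.induction_on with
  | zero => simp
  | add x₁ x₂ h₁ h₂ => rw [map_add, LinearMap.add_apply, mul_add, Complex.add_im, h₁, h₂, add_zero]
  | tmul a x =>
    induction y using TensorProduct.induction_on with
    | zero => simp
    | add y₁ y₂ h₁ h₂ => rw [map_add, mul_add, Complex.add_im, h₁, h₂, add_zero]
    | tmul b y =>
      have hmem : pairingComponent ψ n x y ∈ tate (-n) := by
        simp [pairingComponent]
      obtain ⟨k, hk⟩ := Submodule.mem_span_singleton.1 hmem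
      have h0 : (2 * Real.pi * Complex.I : ℂ) ^ n ≠ 0 := zpow_ne_zero _ Complex.two_pi_I_ne_zero
      have : (2 * Real.pi * Complex.I : ℂ) ^ n *
          extendR (pairingComponent ψ n) (a ⊗ₜ x) (b ⊗ₜ y) = ((a * b * k : ℝ) : ℂ) := by
        rw [extendR_tmul, ← hk, zpow_neg, zsmul_eq_mul]
        push_cast
        field_simp
      rw [this, Complex.ofReal_im]

lemma coe_hodgeForm [Module.Free ℤ L] [Module.Finite ℤ L] (H : IntegralHodgeStructure L)
    (ψ : L →ₗ[ℤ] L →ₗ[ℤ] ⨁ n : ℤ, tate (-n)) (n : ℤ) (x y : ℝ ⊗[ℤ] L) :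
    (hodgeForm H ψ n x y : ℂ) =
      (2 * Real.pi * Complex.I : ℂ) ^ n * extendR (pairingComponent ψ n) x (H.weil y) :=
  Complex.ext rfl (by rw [Complex.ofReal_im, im_mul_extendR])

/-- `ψ : L × L → ⨁ₙ ℤ(-n)` is a polarisation on `(L, h)`: it respects the gradings by weights
(`L^n × L^n → ℤ(-n)`, and distinct weights are orthogonal), and for each `n` its restriction
to `L^n` is a polarisation of the pure Hodge structure `L^n` of weight `n`. -/
structure IsPolarisation [Module.Free ℤ L] [Module.Finite ℤ L] (H : IntegralHodgeStructure L)
    (ψ : L →ₗ[ℤ] L →ₗ[ℤ] ⨁ n : ℤ, tate (-n)) : Prop where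
  graded : ∀ n : ℤ, ∀ x ∈ H.latticeWeight n, ∀ y ∈ H.latticeWeight n,
    ψ x y ∈ LinearMap.range (DirectSum.lof ℤ ℤ (fun n : ℤ => tate (-n)) n)
  orthogonal : ∀ n m : ℤ, n ≠ m → ∀ x ∈ H.latticeWeight n, ∀ y ∈ H.latticeWeight m, ψ x y = 0
  equivariant : ∀ n : ℤ, ∀ x ∈ H.weight n, ∀ y ∈ H.weight n, ∀ z : ℂˣ,
    extendR (pairingComponent ψ n) (H.h z x) (H.h z y) =
      ((z : ℂ) * conj (z : ℂ)) ^ (-n) * extendR (pairingComponent ψ n) x y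
  symm : ∀ n : ℤ, ∀ x ∈ H.weight n, ∀ y ∈ H.weight n, hodgeForm H ψ n x y = hodgeForm H ψ n y x
  posDef : ∀ n : ℤ, ∀ x ∈ H.weight n, x ≠ 0 → 0 < hodgeForm H ψ n x x

variable (L) in
/-- A polarised integral Hodge structure `(L, ψ, h)` on the lattice `L`. -/
structure PolarisedHodgeStructure [Module.Free ℤ L] [Module.Finite ℤ L]
    extends IntegralHodgeStructure L where
  ψ : L →ₗ[ℤ] L →ₗ[ℤ] ⨁ n : ℤ, tate (-n)
  isPolarisation : IsPolarisation toIntegralHodgeStructure ψ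

namespace PolarisedHodgeStructure

variable [Module.Free ℤ L] [Module.Finite ℤ L] (S : PolarisedHodgeStructure L)

/-- A sublattice `N` of `L` is a Hodge substructure if `N_ℝ ⊆ L_ℝ` is stable under `h`. -/
def IsSubstructure (N : Submodule ℤ L) : Prop :=
  ∀ z : ℂˣ, ∀ x ∈ N.baseChange ℝ, S.h z x ∈ N.baseChange ℝ

/-- `N = M₁ ⊥ ⋯ ⊥ M_r` is an orthogonal decomposition of the sublattice `N` (with the form and
the action of `ℂˣ` restricted from `L`) into Hodge substructures. For `N = ⊤` it is an
orthogonal decomposition of `(L, ψ, h)`. -/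
structure IsOrthogonalDecomposition (N : Submodule ℤ L) {r : ℕ} (M : Fin r → Submodule ℤ L) :
    Prop where
  isSubstructure : ∀ i, S.IsSubstructure (M i)
  independent : iSupIndep M
  iSup_eq : ⨆ i, M i = N
  orthogonal : ∀ i j, i ≠ j → ∀ x ∈ M i, ∀ y ∈ M j, S.ψ x y = 0

/-- The Hodge substructure `N` of `(L, ψ, h)`, with the restricted form and Hodge structure, is
indecomposable: it is nonzero and in every orthogonal decomposition `N = M₁ ⊥ M₂` one has
`M₁ = 0` or `M₂ = 0`. -/
def IsIndecomposable (N : Submodule ℤ L) : Prop :=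
  N ≠ ⊥ ∧ ∀ M₁ M₂ : Submodule ℤ L, S.IsOrthogonalDecomposition N ![M₁, M₂] → M₁ = ⊥ ∨ M₂ = ⊥

end PolarisedHodgeStructure

end Integral

end Hodge

end

/-! This is the argument for unique decomposition of positive definite lattices, with Hodge
structures carried along. Summing the forms `(2πi)^n ψ(x, C y)` over the weights gives a symmetric
positive definite form φ on `L_ℝ` (`totalForm_symm`, `totalForm_pos`), so `L` has finitely many
vectors of bounded φ-norm. Hodge substructures are stable under `C`, so ψ-orthogonality implies
φ-orthogonality (`totalForm_eq_zero`), and every splitting of `L` yields a φ-orthogonal projection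
of the lattice.

Any two such projections commute (`projections_commute`). Hence a splitting `L = A' ⊥ B'` cuts each
summand `A` of another splitting into `A ∩ A'` and `A ∩ B'`. An indecomposable `N i` therefore lies
in `N' j` or in its complement, for each `j`; by positivity it cannot lie in all the complements. By
symmetry `N i ≤ N' j ≤ N k`, and independence forces `k = i`. -/

open scoped TensorProduct DirectSum ComplexConjugate

namespace Hodge

/-! ### Weight spaces -/

section Weight

variable {V : Type*} [AddCommGroup V] [Module ℝ V] (H : HodgeDecomposition V)

lemma reC_inclC (v : V) : reC V (inclC V v) = v := by
  simp [reC, inclC]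

lemma inclC_injective : Function.Injective (inclC V) :=
  Function.LeftInverse.injective reC_inclC

namespace HodgeDecomposition

lemma h_mem_weight (z : ℂˣ) {n : ℤ} {v : V} (hv : v ∈ H.weight n) : H.h z v ∈ H.weight n := by
  have hv' : inclC V v ∈ ⨆ pq : {pq : ℤ × ℤ // pq.1 + pq.2 = n}, H.piece pq.1 := hv
  have key : ∀ w ∈ ⨆ pq : {pq : ℤ × ℤ // pq.1 + pq.2 = n}, H.piece pq.1,
      H.hC z (star z) w ∈ ⨆ pq : {pq : ℤ × ℤ // pq.1 + pq.2 = n}, H.piece pq.1 := by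
    intro w hw
    induction hw using Submodule.iSup_induction' with
    | mem pq v hv =>
      rw [H.hC_apply z (star z) pq.1 hv]
      exact Submodule.smul_mem _ _ (Submodule.mem_iSup_of_mem pq hv)
    | zero => simp
    | add x y _ _ hx hy => rw [map_add]; exact add_mem hx hy
  have hz := key _ hv'
  rw [← inclC_h] at hz
  exact hz

/-- On `V^{p,q}` a real scalar acts through `p + q` alone, and powers of 2 tell the weights apart.
-/
lemma h_two_of_mem_weight {n : ℤ} {v : V} (hv : v ∈ H.weight n) :
    H.h (Units.mk0 2 two_ne_zero) v = (2 : ℝ) ^ (-n) • v := by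
  apply inclC_injective
  have hv' : inclC V v ∈ ⨆ pq : {pq : ℤ × ℤ // pq.1 + pq.2 = n}, H.piece pq.1 := hv
  have key : ∀ w ∈ ⨆ pq : {pq : ℤ × ℤ // pq.1 + pq.2 = n}, H.piece pq.1,
      H.hC (Units.mk0 2 two_ne_zero) (star (Units.mk0 2 two_ne_zero)) w
        = ((2 : ℝ) ^ (-n)) • w := by
    intro w hw
    induction hw using Submodule.iSup_induction' with
    | mem pq v hv =>
      rw [H.hC_apply _ _ pq.1 hv, ← algebraMap_smul ℂ ((2 : ℝ) ^ (-n)) v]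
      congr 1
      have h2 : (star (Units.mk0 (2 : ℂ) two_ne_zero)) = Units.mk0 2 two_ne_zero := by
        ext; simp
      have hn : -pq.1.1 + -pq.1.2 = -n := by rw [← neg_add, pq.2]
      rw [h2, ← zpow_add, hn]
      simp
    | zero => simp
    | add x y _ _ hx hy => rw [map_add, hx, hy, smul_add]
  rw [inclC_h, key _ hv', map_smul]

/-- The weight spaces are eigenspaces of `h(2)` for distinct eigenvalues. -/
lemma iSupIndep_weight : iSupIndep H.weight := by
  have hinj : Function.Injective fun n : ℤ => (2 : ℝ) ^ (-n) := fun a b hab =>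
    neg_injective (zpow_right_injective₀ two_pos (by norm_num) hab)
  refine ((Module.End.eigenspaces_iSupIndep (H.h (Units.mk0 2 two_ne_zero))).comp hinj).mono ?_
  intro n v hv
  exact Module.End.mem_eigenspace_iff.2 (H.h_two_of_mem_weight hv)

end HodgeDecomposition

end Weight

/-! ### Extension of scalars -/

section BaseChange

variable {L : Type*} [AddCommGroup L]

lemma baseChange_le {A : Submodule ℤ L} {P : Submodule ℝ (ℝ ⊗[ℤ] L)}
    (h : ∀ x ∈ A, (1 : ℝ) ⊗ₜ[ℤ] x ∈ P) : A.baseChange ℝ ≤ P := by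
  rw [Submodule.baseChange_eq_span, Submodule.span_le]
  rintro _ ⟨x, hx, rfl⟩
  exact h x hx

lemma one_tmul_mem_baseChange {A : Submodule ℤ L} {x : L} (hx : x ∈ A) :
    (1 : ℝ) ⊗ₜ[ℤ] x ∈ A.baseChange ℝ :=
  Submodule.tmul_mem_baseChange_of_mem 1 hx

lemma baseChange_iSup {ι : Sort*} (A : ι → Submodule ℤ L) :
    (⨆ i, A i).baseChange ℝ = ⨆ i, (A i).baseChange ℝ := by
  refine le_antisymm (baseChange_le fun x hx => ?_)
    (iSup_le fun i => Submodule.baseChange_mono ℝ (le_iSup A i))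
  induction hx using Submodule.iSup_induction' with
  | mem i x hx => exact Submodule.mem_iSup_of_mem i (one_tmul_mem_baseChange hx)
  | zero => simp
  | add x y _ _ hx hy => rw [TensorProduct.tmul_add]; exact add_mem hx hy

lemma baseChange_mem {A : Submodule ℤ L} {g : L →ₗ[ℤ] L} (h : ∀ x, g x ∈ A) (v : ℝ ⊗[ℤ] L) :
    g.baseChange ℝ v ∈ A.baseChange ℝ := by
  have : (⊤ : Submodule ℤ L).baseChange ℝ ≤ (A.baseChange ℝ).comap (g.baseChange ℝ) :=
    baseChange_le fun x _ => by simpa using one_tmul_mem_baseChange (h x)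
  exact this (by rw [Submodule.baseChange_top]; trivial)

lemma baseChange_apply_eq_self {A : Submodule ℤ L} {g : L →ₗ[ℤ] L} (h : ∀ x ∈ A, g x = x)
    {v : ℝ ⊗[ℤ] L} (hv : v ∈ A.baseChange ℝ) : g.baseChange ℝ v = v := by
  have : A.baseChange ℝ ≤ LinearMap.eqLocus (g.baseChange ℝ) LinearMap.id :=
    baseChange_le fun x hx => by simp [h x hx]
  exact this hv

lemma extendR_eq_zero {B : L →ₗ[ℤ] L →ₗ[ℤ] ℂ} {A A' : Submodule ℤ L}
    (h : ∀ x ∈ A, ∀ y ∈ A', B x y = 0) {v w : ℝ ⊗[ℤ] L} (hv : v ∈ A.baseChange ℝ)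
    (hw : w ∈ A'.baseChange ℝ) : extendR B v w = 0 := by
  have h₁ : ∀ x ∈ A, A'.baseChange ℝ ≤ LinearMap.ker (extendR B ((1 : ℝ) ⊗ₜ[ℤ] x)) :=
    fun x hx => baseChange_le fun y hy => by
      simp [extendR_tmul, h x hx y hy]
  have h₂ : A.baseChange ℝ ≤ LinearMap.ker ((extendR B).flip w) :=
    baseChange_le fun x hx => h₁ x hx hw
  exact h₂ hv

lemma inclR_injective [Module.Free ℤ L] : Function.Injective (inclR L) := by
  let b := Module.Free.chooseBasis ℤ L
  refine (injective_iff_map_eq_zero _).2 fun x hx => b.repr.map_eq_zero_iff.1 ?_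
  ext i
  have h := congrArg (fun v => (b.baseChange ℝ).repr v i) hx
  change (b.baseChange ℝ).repr ((1 : ℝ) ⊗ₜ[ℤ] x) i = (b.baseChange ℝ).repr 0 i at h
  simpa using h

/-- A lattice has finitely many vectors of bounded norm for a positive definite form. -/
lemma finite_setOf_form_le [Module.Free ℤ L] [Module.Finite ℤ L]
    (φ : (ℝ ⊗[ℤ] L) →ₗ[ℝ] (ℝ ⊗[ℤ] L) →ₗ[ℝ] ℝ) (hsymm : ∀ v w, φ v w = φ w v)
    (hpos : ∀ v, v ≠ 0 → 0 < φ v v) (c : ℝ) :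
    {x : L | φ ((1 : ℝ) ⊗ₜ[ℤ] x) ((1 : ℝ) ⊗ₜ[ℤ] x) ≤ c}.Finite := by
  let core : InnerProductSpace.Core ℝ (ℝ ⊗[ℤ] L) :=
    { inner := fun v w => φ v w
      conj_inner_symm := fun v w => by simpa using hsymm w v
      re_inner_nonneg := fun v => by
        rcases eq_or_ne v 0 with rfl | hv
        · simp
        · exact (hpos v hv).le
      add_left := fun u v w => by simp
      smul_left := fun v w r => by simp
      definite := fun v hv => by
        by_contra h
        exact (hpos v h).ne' hv }
  let _ : NormedAddCommGroup (ℝ ⊗[ℤ] L) := core.toNormedAddCommGroup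
  let _ : InnerProductSpace ℝ (ℝ ⊗[ℤ] L) := InnerProductSpace.ofCore core.toCore
  let b := Module.Free.chooseBasis ℤ L
  let bR : Module.Basis _ ℝ (ℝ ⊗[ℤ] L) := b.baseChange ℝ
  have : FiniteDimensional ℝ (ℝ ⊗[ℤ] L) := bR.finiteDimensional_of_finite
  have : ProperSpace (ℝ ⊗[ℤ] L) := FiniteDimensional.proper_real _
  -- For `c < 0` the radius is 0, which is harmless: the set of short vectors is then empty.
  have hfin := ZSpan.setFinite_inter bR
    (s := Metric.closedBall 0 (Real.sqrt c)) Metric.isBounded_closedBall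
  refine Set.Finite.of_finite_image (f := inclR L) (hfin.subset ?_) inclR_injective.injOn
  rintro _ ⟨x, hx, rfl⟩
  refine ⟨?_, ?_⟩
  · rw [mem_closedBall_zero_iff]
    refine Real.le_sqrt_of_sq_le ?_
    rw [← real_inner_self_eq_norm_sq]
    exact hx
  · have : x ∈ Submodule.span ℤ (Set.range b) := by rw [b.span_eq]; trivial
    have h2 := Submodule.mem_map_of_mem (f := inclR L) this
    rw [Submodule.map_span, ← Set.range_comp] at h2
    have h3 : inclR L ∘ b = bR := by
      funext i
      exact (Module.Basis.baseChange_apply ℝ b i).symm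
    rwa [h3] at h2

end BaseChange

/-! ### Commuting orthogonal projections -/

/-- Orthogonal projections of a lattice with a discrete positive definite form commute. -/
lemma projections_commute {L : Type*} [AddCommGroup L] (φ : L →+ L →+ ℝ)
    (hpos : ∀ x, x ≠ 0 → 0 < φ x x) (hfin : ∀ c, {x : L | φ x x ≤ c}.Finite)
    (e f : L →ₗ[ℤ] L)
    (he₁ : ∀ x, φ (e x) (x - e x) = 0) (he₂ : ∀ x, φ (x - e x) (e x) = 0)
    (hf₁ : ∀ x, φ (f x) (x - f x) = 0) (hf₂ : ∀ x, φ (x - f x) (f x) = 0) (x : L) :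
    e (f x) = f (e x) := by
  by_contra hx
  -- A shortest counterexample exists because only finitely many vectors are no longer than `x`.
  obtain ⟨m, ⟨hm, hmx⟩, hmin⟩ := Set.exists_min_image
    {y : L | e (f y) ≠ f (e y) ∧ φ y y ≤ φ x x} (fun y => φ y y)
    ((hfin (φ x x)).subset fun y hy => hy.2) ⟨x, hx, le_rfl⟩
  have hsmall : ∀ y, φ y y < φ m m → e (f y) = f (e y) := fun y hy => by
    by_contra hne
    exact absurd (hmin y ⟨hne, hy.le.trans hmx⟩) (not_le.2 hy)
  -- Otherwise, by Pythagoras, `g m` and `m - g m` are both shorter than `m`; `e` and `f` commute on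
  -- each, hence on their sum `m`.
  have key : ∀ g : L →ₗ[ℤ] L, φ (g m) (m - g m) = 0 → φ (m - g m) (g m) = 0 →
      g m = 0 ∨ g m = m := by
    intro g h₁ h₂
    by_contra! hg
    have hsum : φ m m = φ (g m) (g m) + φ (m - g m) (m - g m) := by
      conv_lhs => rw [show m = g m + (m - g m) by abel]
      rw [map_add, map_add, AddMonoidHom.add_apply, AddMonoidHom.add_apply, h₁, h₂]
      ring
    have p₁ := hpos _ hg.1
    have p₂ := hpos _ (sub_ne_zero.2 hg.2.symm)
    have c₁ := hsmall (g m) (by linarith)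
    have c₂ := hsmall (m - g m) (by linarith)
    apply hm
    rw [show m = g m + (m - g m) by abel, map_add, map_add, map_add, map_add, c₁, c₂]
  rcases key e (he₁ m) (he₂ m) with h | h <;> rcases key f (hf₁ m) (hf₂ m) with h' | h' <;>
    simp [h, h'] at hm

/-! ### The form of a polarised Hodge structure -/

namespace PolarisedHodgeStructure

variable {L : Type*} [AddCommGroup L] [Module.Free ℤ L] [Module.Finite ℤ L]
  (S : PolarisedHodgeStructure L)

/-- Transfers the polarisation axioms stated on lattice vectors to the real weight spaces. The
lattice weights span `L_ℝ`, and independence of the real weights leaves no room for a larger space.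
-/
lemma weight_eq_baseChange (n : ℤ) : S.weight n = (S.latticeWeight n).baseChange ℝ := by
  have hle : ∀ m, (S.latticeWeight m).baseChange ℝ ≤ S.weight m :=
    fun m => baseChange_le fun x hx => hx
  refine le_antisymm ?_ (hle n)
  have htop : ⨆ m, (S.latticeWeight m).baseChange ℝ = ⊤ := by
    rw [← baseChange_iSup, ← Submodule.baseChange_top]
    congr 1
    exact S.weight_isInternal.submodule_iSup_eq_top
  have hsup : (⊤ : Submodule ℝ (ℝ ⊗[ℤ] L)) ≤
      (S.latticeWeight n).baseChange ℝ ⊔ ⨆ (m) (_ : m ≠ n), S.weight m := by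
    rw [← htop]
    refine iSup_le fun m => ?_
    rcases eq_or_ne m n with rfl | h
    · exact le_sup_left
    · exact le_sup_of_le_right ((hle m).trans (le_iSup₂_of_le m h le_rfl))
  -- Modular law, with the lattice part contained in the weight space.
  calc S.weight n ≤ ((S.latticeWeight n).baseChange ℝ ⊔ ⨆ (m) (_ : m ≠ n), S.weight m)
        ⊓ S.weight n := le_inf (le_top.trans hsup) le_rfl
    _ = (S.latticeWeight n).baseChange ℝ ⊔ ((⨆ (m) (_ : m ≠ n), S.weight m) ⊓ S.weight n) :=
        sup_inf_assoc_of_le _ (hle n)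
    _ = (S.latticeWeight n).baseChange ℝ := by
        rw [inf_comm, (S.iSupIndep_weight n).eq_bot, sup_bot_eq]

lemma iSup_weight : ⨆ n, S.weight n = ⊤ := by
  simp_rw [S.weight_eq_baseChange]
  rw [← baseChange_iSup, ← Submodule.baseChange_top]
  congr 1
  exact S.weight_isInternal.submodule_iSup_eq_top

lemma finite_weights : {n | S.weight n ≠ ⊥}.Finite :=
  WellFoundedGT.finite_ne_bot_of_iSupIndep S.iSupIndep_weight

/-- `hodgeForm` as a bilinear map. -/
noncomputable def weightForm (n : ℤ) : (ℝ ⊗[ℤ] L) →ₗ[ℝ] (ℝ ⊗[ℤ] L) →ₗ[ℝ] ℝ :=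
  ((extendR (pairingComponent S.ψ n)).compl₂ S.weil).compr₂
    (Complex.reLm ∘ₗ LinearMap.mulLeft ℝ ((2 * Real.pi * Complex.I : ℂ) ^ n))

lemma weightForm_apply (n : ℤ) (v w : ℝ ⊗[ℤ] L) :
    S.weightForm n v w = hodgeForm S.toIntegralHodgeStructure S.ψ n v w := rfl

lemma weightForm_eq_zero {A A' : Submodule ℤ L} {n : ℤ}
    (h : ∀ x ∈ A, ∀ y ∈ A', pairingComponent S.ψ n x y = 0) {v w : ℝ ⊗[ℤ] L}
    (hv : v ∈ A.baseChange ℝ) (hw : S.weil w ∈ A'.baseChange ℝ) : S.weightForm n v w = 0 := by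
  rw [weightForm_apply, hodgeForm, extendR_eq_zero h hv hw, mul_zero, Complex.zero_re]

/-- The sum over all weights `n` of the forms `(2πi)^n ψ(x, C y)`. -/
noncomputable def totalForm : (ℝ ⊗[ℤ] L) →ₗ[ℝ] (ℝ ⊗[ℤ] L) →ₗ[ℝ] ℝ :=
  ∑ n ∈ S.finite_weights.toFinset, S.weightForm n

lemma totalForm_apply (v w : ℝ ⊗[ℤ] L) :
    S.totalForm v w = ∑ n ∈ S.finite_weights.toFinset, S.weightForm n v w := by
  simp [totalForm, LinearMap.sum_apply]

lemma pairingComponent_eq_zero {x y : L} (h : S.ψ x y = 0) (n : ℤ) :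
    pairingComponent S.ψ n x y = 0 := by
  simp [pairingComponent, h]

/-- Stability of `A'` under `h(i)` keeps `C w` in the real span of `A'`. -/
lemma totalForm_eq_zero {A A' : Submodule ℤ L} (hA' : S.IsSubstructure A')
    (h : ∀ x ∈ A, ∀ y ∈ A', S.ψ x y = 0) {v w : ℝ ⊗[ℤ] L}
    (hv : v ∈ A.baseChange ℝ) (hw : w ∈ A'.baseChange ℝ) : S.totalForm v w = 0 := by
  rw [totalForm_apply]
  exact Finset.sum_eq_zero fun n _ => S.weightForm_eq_zero
    (fun x hx y hy => S.pairingComponent_eq_zero (h x hx y hy) n) hv (hA' _ _ hw)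

lemma totalForm_of_ne {m k : ℤ} (hmk : m ≠ k) {v w : ℝ ⊗[ℤ] L} (hv : v ∈ S.weight m)
    (hw : w ∈ S.weight k) : S.totalForm v w = 0 := by
  have hw' := S.h_mem_weight (Units.mk0 Complex.I Complex.I_ne_zero) hw
  rw [weight_eq_baseChange] at hv hw'
  rw [totalForm_apply]
  exact Finset.sum_eq_zero fun n _ => S.weightForm_eq_zero
    (fun x hx y hy => S.pairingComponent_eq_zero
      (S.isPolarisation.orthogonal m k hmk x hx y hy) n) hv hw'

lemma totalForm_of_mem_weight {m : ℤ} {v w : ℝ ⊗[ℤ] L} (hv : v ∈ S.weight m)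
    (hw : w ∈ S.weight m) :
    S.totalForm v w = hodgeForm S.toIntegralHodgeStructure S.ψ m v w := by
  rw [totalForm_apply, ← weightForm_apply]
  refine Finset.sum_eq_single m (fun n _ hnm => ?_) (fun hm => ?_)
  · have hw' := S.h_mem_weight (Units.mk0 Complex.I Complex.I_ne_zero) hw
    rw [weight_eq_baseChange] at hv hw'
    refine S.weightForm_eq_zero (fun x hx y hy => ?_) hv hw'
    obtain ⟨t, ht⟩ := S.isPolarisation.graded m x hx y hy
    simp [pairingComponent, ← ht, DirectSum.component.of, hnm.symm]
  -- A weight absent from the sum has zero weight space.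
  · have hbot : S.weight m = ⊥ := by simpa using hm
    rw [hbot, Submodule.mem_bot] at hv
    simp [hv]

lemma totalForm_symm (v w : ℝ ⊗[ℤ] L) : S.totalForm v w = S.totalForm w v := by
  have hv : v ∈ ⨆ n, S.weight n := by rw [S.iSup_weight]; trivial
  have hw : w ∈ ⨆ n, S.weight n := by rw [S.iSup_weight]; trivial
  induction hv using Submodule.iSup_induction' with
  | mem m v hv =>
    induction hw using Submodule.iSup_induction' with
    | mem k w hw =>
      rcases eq_or_ne m k with rfl | h
      · rw [S.totalForm_of_mem_weight hv hw, S.totalForm_of_mem_weight hw hv]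
        exact S.isPolarisation.symm m v hv w hw
      · rw [S.totalForm_of_ne h hv hw, S.totalForm_of_ne h.symm hw hv]
    | zero => simp
    | add x y _ _ hx hy => simp [hx, hy]
  | zero => simp
  | add x y _ _ hx hy => simp [hx, hy]

lemma totalForm_pos {v : ℝ ⊗[ℤ] L} (hv : v ≠ 0) : 0 < S.totalForm v v := by
  have hmem : v ∈ ⨆ n, S.weight n := by rw [S.iSup_weight]; trivial
  obtain ⟨f, hf, rfl⟩ := (Submodule.mem_iSup_iff_exists_finsupp _ _).1 hmem
  have hdiag : S.totalForm (f.sum fun _ x => x) (f.sum fun _ x => x) =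
      ∑ n ∈ f.support, S.totalForm (f n) (f n) := by
    simp only [Finsupp.sum, map_sum, LinearMap.sum_apply]
    refine Finset.sum_congr rfl fun n hn => ?_
    exact Finset.sum_eq_single n (fun m _ hmn => S.totalForm_of_ne hmn (hf m) (hf n))
      (fun h => absurd hn h)
  rw [hdiag]
  refine Finset.sum_pos (fun n hn => ?_) ?_
  · rw [S.totalForm_of_mem_weight (hf n) (hf n)]
    exact S.isPolarisation.posDef n _ (hf n) (Finsupp.mem_support_iff.1 hn)
  · rw [Finset.nonempty_iff_ne_empty]
    intro h
    exact hv (by simp [Finsupp.sum, h])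

/-! ### Orthogonal complements and uniqueness -/

/-- `L = A ⊥ B` as a sum of two mutually orthogonal Hodge substructures. -/
structure IsOrthogonalPair (A B : Submodule ℤ L) : Prop where
  isCompl : IsCompl A B
  left : S.IsSubstructure A
  right : S.IsSubstructure B
  orthogonal : ∀ x ∈ A, ∀ y ∈ B, S.ψ x y = 0
  orthogonal' : ∀ x ∈ B, ∀ y ∈ A, S.ψ x y = 0

variable {S}

lemma IsOrthogonalPair.symm {A B : Submodule ℤ L} (h : S.IsOrthogonalPair A B) :
    S.IsOrthogonalPair B A :=
  ⟨h.isCompl.symm, h.right, h.left, h.orthogonal', h.orthogonal⟩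

lemma isSubstructure_iSup {ι : Sort*} {A : ι → Submodule ℤ L}
    (h : ∀ i, S.IsSubstructure (A i)) : S.IsSubstructure (⨆ i, A i) := by
  intro z x hx
  rw [baseChange_iSup] at hx ⊢
  induction hx using Submodule.iSup_induction' with
  | mem i x hx => exact Submodule.mem_iSup_of_mem i (h i z x hx)
  | zero => simp
  | add x y _ _ hx hy => rw [map_add]; exact add_mem hx hy

lemma IsOrthogonalDecomposition.isOrthogonalPair {r : ℕ} {N : Fin r → Submodule ℤ L}
    (h : S.IsOrthogonalDecomposition ⊤ N) (i : Fin r) :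
    S.IsOrthogonalPair (N i) (⨆ (j) (_ : j ≠ i), N j) where
  isCompl := by
    refine ⟨h.independent i, codisjoint_iff_le_sup.2 ?_⟩
    rw [← h.iSup_eq]
    refine iSup_le fun j => ?_
    rcases eq_or_ne j i with rfl | hj
    · exact le_sup_left
    · exact le_sup_of_le_right (le_iSup₂_of_le j hj le_rfl)
  left := h.isSubstructure i
  right := isSubstructure_iSup fun j => isSubstructure_iSup fun _ => h.isSubstructure j
  orthogonal x hx y hy := by
    have : ⨆ (j) (_ : j ≠ i), N j ≤ LinearMap.ker (S.ψ x) :=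
      iSup₂_le fun j hj y hy => h.orthogonal i j hj.symm x hx y hy
    exact this hy
  orthogonal' x hx y hy := by
    have : ⨆ (j) (_ : j ≠ i), N j ≤ LinearMap.ker (S.ψ.flip y) :=
      iSup₂_le fun j hj x hx => h.orthogonal j i hj x hx y hy
    exact this hx

namespace IsOrthogonalPair

variable {A B A' B' : Submodule ℤ L}

/-- Both projections are φ-orthogonal, so the lattice argument applies. -/
lemma projection_comm (h : S.IsOrthogonalPair A B) (h' : S.IsOrthogonalPair A' B') (x : L) :
    A.projection B h.isCompl (A'.projection B' h'.isCompl x) =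
      A'.projection B' h'.isCompl (A.projection B h.isCompl x) := by
  let φ : L →+ L →+ ℝ := AddMonoidHom.mk'
    (fun x => ((S.totalForm (inclR L x)).toAddMonoidHom.comp (inclR L).toAddMonoidHom))
    (fun x y => by ext; simp)
  have hφ : ∀ x y, φ x y = S.totalForm ((1 : ℝ) ⊗ₜ[ℤ] x) ((1 : ℝ) ⊗ₜ[ℤ] y) := fun _ _ => rfl
  have horth : ∀ {A B : Submodule ℤ L} (h : S.IsOrthogonalPair A B) (x : L),
      φ (A.projection B h.isCompl x) (x - A.projection B h.isCompl x) = 0 := by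
    intro A B h x
    rw [hφ]
    refine S.totalForm_eq_zero h.right h.orthogonal
      (one_tmul_mem_baseChange (Submodule.projection_apply_mem _ x))
      (one_tmul_mem_baseChange ?_)
    rw [← Submodule.projection_apply_eq_zero_iff h.isCompl, map_sub,
      Submodule.projection_apply_of_mem_left h.isCompl (Submodule.projection_apply_mem _ x),
      sub_self]
  have hsymm : ∀ x y, φ x y = φ y x := fun x y => S.totalForm_symm _ _
  refine projections_commute φ (fun x hx => S.totalForm_pos fun h0 => hx (inclR_injective ?_))
    (finite_setOf_form_le S.totalForm S.totalForm_symm fun v hv => S.totalForm_pos hv)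
    _ _ (horth h) (fun x => ?_) (horth h') (fun x => ?_) x
  · rw [map_zero]; exact h0
  · rw [hsymm, horth h]
  · rw [hsymm, horth h']

lemma projection_mem_inf (h : S.IsOrthogonalPair A B) (h' : S.IsOrthogonalPair A' B') {x : L}
    (hx : x ∈ A) : A'.projection B' h'.isCompl x ∈ A ⊓ A' := by
  refine ⟨?_, Submodule.projection_apply_mem _ x⟩
  rw [← Submodule.projection_apply_of_mem_left h.isCompl hx, ← h.projection_comm h']
  exact Submodule.projection_apply_mem _ _

/-- The composite of the two projections maps `L` into `A ⊓ A'`, and its real extension fixes every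
vector lying in both real spans. This places `h z v` in the real span of the intersection. -/
lemma isSubstructure_inf (h : S.IsOrthogonalPair A B) (h' : S.IsOrthogonalPair A' B') :
    S.IsSubstructure (A ⊓ A') := by
  intro z v hv
  have h₁ : S.h z v ∈ A.baseChange ℝ := h.left z v (Submodule.baseChange_mono ℝ inf_le_left hv)
  have h₂ : S.h z v ∈ A'.baseChange ℝ := h'.left z v (Submodule.baseChange_mono ℝ inf_le_right hv)
  have e₁ := baseChange_apply_eq_self (g := A.projection B h.isCompl)
    (fun x hx => Submodule.projection_apply_of_mem_left h.isCompl hx) h₁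
  have e₂ := baseChange_apply_eq_self (g := A'.projection B' h'.isCompl)
    (fun x hx => Submodule.projection_apply_of_mem_left h'.isCompl hx) h₂
  rw [← e₂]
  nth_rewrite 1 [← e₁]
  rw [← LinearMap.comp_apply, ← LinearMap.baseChange_comp]
  refine baseChange_mem (fun x => ?_) _
  rw [LinearMap.comp_apply]
  exact h.projection_mem_inf h' (Submodule.projection_apply_mem _ x)

/-- A second orthogonal pair induces an orthogonal decomposition of `A`. -/
lemma isOrthogonalDecomposition_inf (h : S.IsOrthogonalPair A B)
    (h' : S.IsOrthogonalPair A' B') :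
    S.IsOrthogonalDecomposition A ![A ⊓ A', A ⊓ B'] where
  isSubstructure i := by
    fin_cases i
    · exact h.isSubstructure_inf h'
    · exact h.isSubstructure_inf h'.symm
  independent := by
    have hd : Disjoint (A ⊓ A') (A ⊓ B') :=
      h'.isCompl.disjoint.mono inf_le_right inf_le_right
    rw [iSupIndep_pair (i := (0 : Fin 2)) (j := 1) (by decide) (by intro k; fin_cases k <;> simp)]
    exact hd
  iSup_eq := by
    refine le_antisymm (iSup_le fun i => by fin_cases i <;> exact inf_le_left) fun x hx => ?_
    rw [← Submodule.projection_add_projection_eq_self h'.isCompl x]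
    exact add_mem (Submodule.mem_iSup_of_mem (0 : Fin 2) (h.projection_mem_inf h' hx))
      (Submodule.mem_iSup_of_mem (1 : Fin 2) (h.projection_mem_inf h'.symm hx))
  orthogonal i j hij x hx y hy := by
    fin_cases i <;> fin_cases j
    · exact absurd rfl hij
    · exact h'.orthogonal x hx.2 y hy.2
    · exact h'.orthogonal' x hx.2 y hy.2
    · exact absurd rfl hij

end IsOrthogonalPair

lemma exists_le_of_isIndecomposable {r s : ℕ} {N : Fin r → Submodule ℤ L}
    {N' : Fin s → Submodule ℤ L} (hN : S.IsOrthogonalDecomposition ⊤ N)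
    (hN' : S.IsOrthogonalDecomposition ⊤ N') {i : Fin r} (hi : S.IsIndecomposable (N i)) :
    ∃ j, N i ≤ N' j := by
  by_contra! hcon
  -- Indecomposability kills one of the two pieces of `N i`; by `hcon` it must be the one inside `N'
  -- j`.
  have hle : ∀ j, N i ≤ ⨆ (k) (_ : k ≠ j), N' k := by
    intro j
    have hd := (hN.isOrthogonalPair i).isOrthogonalDecomposition_inf (hN'.isOrthogonalPair j)
    have hsup : N i ⊓ N' j ⊔ N i ⊓ (⨆ (k) (_ : k ≠ j), N' k) = N i := by
      refine le_antisymm (sup_le inf_le_left inf_le_left) ?_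
      conv_lhs => rw [← hd.iSup_eq]
      refine iSup_le fun k => ?_
      fin_cases k
      · exact le_sup_left
      · exact le_sup_right
    rcases hi.2 _ _ hd with h | h
    · rw [h, bot_sup_eq] at hsup
      exact inf_eq_left.1 hsup
    · rw [h, sup_bot_eq] at hsup
      exact absurd (inf_eq_left.1 hsup) (hcon j)
  obtain ⟨x, hx, hx0⟩ := (Submodule.ne_bot_iff _).1 hi.1
  -- A vector of `N i` is φ-orthogonal to every `N' j`, hence to all of `L`, itself included.
  have hker : ∀ y : L, S.totalForm ((1 : ℝ) ⊗ₜ[ℤ] x) ((1 : ℝ) ⊗ₜ[ℤ] y) = 0 := by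
    intro y
    have htop : y ∈ ⨆ j, N' j := by rw [hN'.iSup_eq]; trivial
    induction htop using Submodule.iSup_induction' with
    | mem j y hy =>
      exact S.totalForm_eq_zero (hN'.isSubstructure j) (hN'.isOrthogonalPair j).orthogonal'
        (one_tmul_mem_baseChange (hle j hx)) (one_tmul_mem_baseChange hy)
    | zero => simp
    | add y z _ _ hy hz => rw [TensorProduct.tmul_add, map_add, hy, hz, add_zero]
  refine (S.totalForm_pos fun h0 => hx0 (inclR_injective ?_)).ne' (hker x)
  rw [map_zero]
  exact h0

end PolarisedHodgeStructure

end Hodge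

/-- If `L = ⊥ᵢ Nᵢ = ⊥ⱼ N'ⱼ` are two orthogonal decompositions of a polarised integral Hodge
structure into indecomposable polarised integral Hodge substructures, then the sets of
sublattices `{Nᵢ}` and `{N'ⱼ}` coincide. -/
theorem theorem1p5 {L : Type*} [AddCommGroup L] [Module.Free ℤ L] [Module.Finite ℤ L]
    (S : Hodge.PolarisedHodgeStructure L) {r s : ℕ}
    (N : Fin r → Submodule ℤ L) (N' : Fin s → Submodule ℤ L)
    (hN : S.IsOrthogonalDecomposition ⊤ N) (hN_ind : ∀ i, S.IsIndecomposable (N i))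
    (hN' : S.IsOrthogonalDecomposition ⊤ N') (hN'_ind : ∀ j, S.IsIndecomposable (N' j)) :
    Set.range N = Set.range N' := by

  have key : ∀ {r s : ℕ} {N : Fin r → Submodule ℤ L} {N' : Fin s → Submodule ℤ L},
      S.IsOrthogonalDecomposition ⊤ N → (∀ i, S.IsIndecomposable (N i)) →
      S.IsOrthogonalDecomposition ⊤ N' → (∀ j, S.IsIndecomposable (N' j)) →
      Set.range N ⊆ Set.range N' := by
    rintro r s N N' hN hN_ind hN' hN'_ind _ ⟨i, rfl⟩
    obtain ⟨j, hj⟩ := Hodge.PolarisedHodgeStructure.exists_le_of_isIndecomposable hN hN' (hN_ind i)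
    obtain ⟨k, hk⟩ := Hodge.PolarisedHodgeStructure.exists_le_of_isIndecomposable hN' hN (hN'_ind j)
    -- Distinct summands are disjoint, so `N i ≤ N k` with `i ≠ k` would make `N i` zero.
    have hik : i = k := by
      by_contra hne
      exact (hN_ind i).1 (le_bot_iff.1
        ((hN.independent.pairwiseDisjoint hne) le_rfl (hj.trans hk)))
    subst hik
    exact ⟨j, le_antisymm hk hj⟩
  exact (key hN hN_ind hN' hN'_ind).antisymm (key hN' hN'_ind hN hN_ind)
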